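/- Let $\log$ denote the logarithm to base $2$. For positive integers $n,k$ consider $n$ men and $n$ women. Each participant $x$ has a profile $\mathbf a(x)\in\{0,1\}^k$ and a tie-breaking list $T_x$, an ordering of the members of the opposite side; all $2n$ profiles and all $2n$ lists are independent and uniformly distributed. The distance of two participants is the weighted Hamming distance of their profiles, $d(x,y)=\sum_{i=1}^k 2^{-i}\,\mathbf 1\bigl(a_i(x)\ne a_i(y)\bigr)$. Each participant ranks the members of the opposite side by increasing distance, and members at the same distance in the order of $T_x$. A matching $\mu$ is a map from the set of participants to itself that sends each man to a woman or to himself, each woman to a man or to herself, and satisfies $\mu(x)=y\Rightarrow\mu(y)=x$. It is stable if there is no man $m$ and woman $w$ who strictly prefer each other to $\mu(m)$ and $\mu(w)$ respectively, where being unmatched is worse than having any partner. A stable partner of $x$ is a member of the opposite side to whom $x$ is matched in some stable matching. In every instance there is a stable matching, and for every participant $x$ the distance $d(x,\mu(x))$ is the same for all stable matchings $\mu$; it is called the matching distance of $x$. Let $X$ be the matching distance of a uniformly random participant, chosen independently of the profiles and lists. Fix $\epsilon>0$ and a sequence $k=k(n)$ of natural numbers. (i) If $k(n)>(1+\epsilon)\log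 n$ for all sufficiently large $n$, then as $n\to\infty$ the fraction of the $2n$ participants that have more than one stable partner tends to $0$ in probability, and $\log X/\log n\to-1$ in probability (in particular $\mathbb P(X>0)\to1$; $\log X=-\infty$ if $X=0$). (ii) If $k(n)>(2+\epsilon)\log n$ for all sufficiently large $n$, then with probability tending to $1$ as $n\to\infty$ the profiles are such that the stable matching is unique without resorting to tie-breaking: there is one matching that is the only stable matching for every choice of the tie-breaking lists. -/

import Mathlib

open Filter Topology

noncomputable section

/-- The participants: `Sum.inl i` is the `i`-th man, `Sum.inr j` is the `j`-th woman. -/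
abbrev Person (n : ℕ) : Type := Fin n ⊕ Fin n

/-- The `j`-th member of the side opposite to a participant. -/
def opposite {n : ℕ} : Person n → Fin n → Person n
  | Sum.inl _, j => Sum.inr j
  | Sum.inr _, j => Sum.inl j

/-- Each participant's `k`-bit profile, a point of the hypercube. -/
abbrev Profiles (n k : ℕ) : Type := Person n → Fin k → Bool

/-- Each participant's tie-breaking list: `T x j` is the position of the `j`-th member of the
opposite side in the list of `x` (a smaller position is better). -/
abbrev TieLists (n : ℕ) : Type := Person n → Equiv.Perm (Fin n)

/-- An instance of the profile matching problem: profiles together with tie-breaking lists. -/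
abbrev Market (n k : ℕ) : Type := Profiles n k × TieLists n

/-- Weighted Hamming distance `∑_{i=1}^k 2^{-i} 1(a_i ≠ b_i)`; the index `i : Fin k` starts
at `0`, whence the exponent `i + 1`. -/
def weightedHamming {k : ℕ} (a b : Fin k → Bool) : ℝ :=
  ∑ i : Fin k, if a i ≠ b i then (1 / 2 : ℝ) ^ ((i : ℕ) + 1) else 0

/-- Distance between two participants: the distance between their profiles. -/
def personDist {n k : ℕ} (a : Profiles n k) (x y : Person n) : ℝ :=
  weightedHamming (a x) (a y)

/-- The strict preference list of `x`: the `i`-th member of the opposite side is preferred to the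
`j`-th one if closer, or at the same distance and earlier in the tie-breaking list of `x`. -/
def Prefers {n k : ℕ} (M : Market n k) (x : Person n) (i j : Fin n) : Prop :=
  personDist M.1 x (opposite x i) < personDist M.1 x (opposite x j) ∨
    (personDist M.1 x (opposite x i) = personDist M.1 x (opposite x j) ∧ M.2 x i < M.2 x j)

/-- A (possibly partial) matching: a map from the participants to themselves sending each man to
a woman or to himself and each woman to a man or to herself, with `μ x = y → μ y = x`.
Participants with `μ x = x` are unmatched. -/
@[ext]
structure Matching (n : ℕ) where
  toFun : Person n → Person n
  self_or_opposite : ∀ x, toFun x = x ∨ ∃ j, toFun x = opposite x j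
  symm : ∀ x y, toFun x = y → toFun y = x

/-- Under `μ`, participant `x` would rather be matched with the `j`-th member of the opposite
side: `x` prefers that member to the present partner, if there is one (being unmatched is
worse than having any partner). -/
def WouldSwitch {n k : ℕ} (M : Market n k) (μ : Matching n) (x : Person n) (j : Fin n) : Prop :=
  ∀ i, μ.toFun x = opposite x i → Prefers M x j i

/-- The `i`-th man and the `j`-th woman form a blocking pair for `μ`. -/
def IsBlockingPair {n k : ℕ} (M : Market n k) (μ : Matching n) (i j : Fin n) : Prop :=
  WouldSwitch M μ (Sum.inl i) j ∧ WouldSwitch M μ (Sum.inr j) i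

/-- A matching is stable if it has no blocking pair. -/
def IsStable {n k : ℕ} (M : Market n k) (μ : Matching n) : Prop :=
  ∀ i j, ¬ IsBlockingPair M μ i j

/-- The stable partners of `x`: the members of the opposite side to whom `x` is matched in some
stable matching. -/
def stablePartners {n k : ℕ} (M : Market n k) (x : Person n) : Set (Fin n) :=
  {j | ∃ μ, IsStable M μ ∧ μ.toFun x = opposite x j}

/-- The fraction of the `2n` participants that have more than one stable partner. -/
def multipleFraction {n k : ℕ} (M : Market n k) : ℝ :=
  ({x : Person n | (stablePartners M x).Nontrivial}.ncard : ℝ) / (2 * n)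

open Classical in
/-- The matching distance of `x`: the distance from `x` to the partner of `x` in a stable matching
(a stable matching always exists, and the distance is the same for all of them). -/
def matchingDistance {n k : ℕ} (M : Market n k) (x : Person n) : ℝ :=
  if h : ∃ μ, IsStable M μ then personDist M.1 x (h.choose.toFun x) else 0

/-- With these profiles the stable matching is unique without resorting to tie-breaking:
there is one matching which, for every choice of the tie-breaking lists, is the only
stable matching. -/
def UniqueWithoutTieBreaking {n k : ℕ} (a : Profiles n k) : Prop :=
  ∃ μ : Matching n, ∀ (T : TieLists n) (ν : Matching n), IsStable (a, T) ν ↔ ν = μ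

/-- Probability of an event under the uniform distribution on a finite type. On a finite product
this is the law of independent uniform coordinates. -/
def uniformProb {Ω : Type} (A : Set Ω) : ℝ := (A.ncard : ℝ) / (Nat.card Ω : ℝ)

end

/-! The distance is symmetric and, from a fixed profile, injective in the other one. If two stable
matchings differ, the men preferring the first and the women preferring the second are paired with
each other in both. The first matching has total distance at most that of the second over these men,
and the reverse holds over these women, so equality holds throughout (`IsStable.dist_eq`).
Injectivity then makes all stable partners of a participant equal in profile. Several stable
partners therefore force coinciding profiles, and injective profiles force uniqueness; the expected
number of ordered coinciding pairs is at most `(2n)² / 2^k`.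

For the matching distance, closeness below `2⁻ʲ` means a common prefix of length `j`. Few matching
distances are tiny because few pairs are close (`sum_closePairs_le`). Few are large because, among
participants sharing a prefix, those not matched within distance `2⁻ʲ` are all on one side; their
number is at most the imbalance between the sides (`card_far_le_abs_imbalance`), whose second moment
is small. Markov's inequality concludes, with `2^i` near `n^(1+η)` and `2^j` near `n^(1-η)`. -/

noncomputable section

/-! ### Existence of stable relations by a fixed point. -/

section StableRelation

variable {α β : Type*}

/-- The pairs not rejected by `P` when offered the pairs in `X`. -/
def notRejected (P : α → β → β → Prop) (X : Set (α × β)) : Set (α × β) :=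
  {e | e ∈ X → ∀ b, (e.1, b) ∈ X → ¬ P e.1 b e.2}

theorem notRejected_antitone (P : α → β → β → Prop) : Antitone (notRejected P) :=
  fun _ _ h _ he hX b hb => he (h hX) b (h hb)

theorem exists_mem_notRejected [Finite β] (P : α → β → β → Prop)
    (irrefl : ∀ a b, ¬ P a b b) (trans : ∀ a b c d, P a b c → P a c d → P a b d)
    (X : Set (α × β)) (a : α) (b : β) (h : (a, b) ∈ X) :
    ∃ c, (a, c) ∈ X ∧ (a, c) ∈ notRejected P X ∧ ¬ P a b c := by
  have : Std.Irrefl (P a) := ⟨irrefl a⟩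
  have : IsTrans β (P a) := ⟨trans a⟩
  obtain ⟨c, hc, hmin⟩ := (Finite.wellFounded_of_trans_of_irrefl (P a)).has_min
    {c | (a, c) ∈ X} ⟨b, h⟩
  exact ⟨c, hc, fun _ d hd => hmin d hd, hmin b h⟩

/-- Gale–Shapley: a stable relation exists for strict linear preferences. -/
theorem exists_stable_relation [Finite α] [Finite β]
    (P : α → β → β → Prop) (Q : β → α → α → Prop)
    (irreflP : ∀ a b, ¬ P a b b) (transP : ∀ a b c d, P a b c → P a c d → P a b d)
    (totalP : ∀ a b c, ¬ P a b c → ¬ P a c b → b = c)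
    (irreflQ : ∀ b a, ¬ Q b a a) (transQ : ∀ b a c d, Q b a c → Q b c d → Q b a d)
    (totalQ : ∀ b a c, ¬ Q b a c → ¬ Q b c a → a = c) :
    ∃ R : α → β → Prop, (∀ a b c, R a b → R a c → b = c) ∧ (∀ a c b, R a b → R c b → a = c) ∧
      ∀ a b, (∀ c, R a c → P a b c) → (∀ c, R c b → Q b a c) → False := by
  let sw : Set (α × β) → Set (β × α) := fun X => {e | (e.2, e.1) ∈ X}
  let ws : Set (β × α) → Set (α × β) := fun X => {e | (e.2, e.1) ∈ X}
  -- Composing two antitone maps gives a monotone one, so Knaster–Tarski supplies a fixed point; the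
  -- matched pairs are those offered and not rejected.
  let F : Set (α × β) →o Set (α × β) :=
    ⟨fun X => ws (notRejected Q (sw (notRejected P X))), fun X Y h e he =>
      notRejected_antitone Q (fun _ hx => notRejected_antitone P h hx) he⟩
  obtain ⟨X, hX⟩ : ∃ X, F X = X := ⟨F.lfp, F.map_lfp⟩
  set Y := notRejected P X with hY
  have hX' : ∀ a b, (a, b) ∈ X ↔ (b, a) ∈ notRejected Q (sw Y) := fun a b => by
    conv_lhs => rw [← hX]
    rfl
  refine ⟨fun a b => (a, b) ∈ X ∧ (a, b) ∈ Y, ?_, ?_, ?_⟩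
  · rintro a b c ⟨h1, h2⟩ ⟨h3, h4⟩
    exact totalP a b c (h4 h3 b h1) (h2 h1 c h3)
  · rintro a c b ⟨h1, h2⟩ ⟨h3, h4⟩
    exact totalQ b a c ((hX' c b).1 h3 h4 a h2) ((hX' a b).1 h1 h2 c h4)
  · intro a b hP hQ
    -- If `b` is offered to `a`, the best offer to `a` is matched and not worse. Otherwise `(a, b)`
    -- is vacuously not rejected, hence offered to `b`, whose best offer is matched.
    by_cases h : (a, b) ∈ X
    · obtain ⟨c, hc1, hc2, hc3⟩ := exists_mem_notRejected P irreflP transP X a b h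
      exact hc3 (hP c ⟨hc1, hc2⟩)
    · have hy : (b, a) ∈ sw Y := fun h' => absurd h' h
      obtain ⟨c, hc1, hc2, hc3⟩ := exists_mem_notRejected Q irreflQ transQ (sw Y) b a hy
      exact hc3 (hQ c ⟨(hX' c b).2 hc2, hc1⟩)

end StableRelation

/-! ### Weighted Hamming distance as a binary expansion. -/

section WeightedHamming

variable {k : ℕ}

theorem weightedHamming_nonneg (a b : Fin k → Bool) : 0 ≤ weightedHamming a b :=
  Finset.sum_nonneg fun i _ => by split_ifs <;> positivity

theorem weightedHamming_comm (a b : Fin k → Bool) : weightedHamming a b = weightedHamming b a := by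
  simp only [weightedHamming, ne_comm]

theorem weightedHamming_succ (a b : Fin (k + 1) → Bool) :
    weightedHamming a b =
      ((if a 0 ≠ b 0 then 1 else 0) + weightedHamming (Fin.tail a) (Fin.tail b)) / 2 := by
  simp only [weightedHamming, Fin.sum_univ_succ, Fin.tail, add_div, Finset.sum_div]
  congr 1
  · split_ifs <;> norm_num
  · refine Finset.sum_congr rfl fun i _ => ?_
    by_cases h : a i.succ = b i.succ
    · simp [h]
    · simp only [ne_eq, h, not_false_eq_true, if_true, Fin.val_succ]
      ring

theorem weightedHamming_lt_one (a b : Fin k → Bool) : weightedHamming a b < 1 := by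
  induction k with
  | zero => simp [weightedHamming]
  | succ k ih =>
    rw [weightedHamming_succ]
    have := ih (Fin.tail a) (Fin.tail b)
    split_ifs <;> linarith

theorem weightedHamming_right_injective (a : Fin k → Bool) :
    Function.Injective (weightedHamming a) := by
  induction k with
  | zero => exact fun b c _ => Subsingleton.elim _ _
  | succ k ih =>
    intro b c h
    simp only [weightedHamming_succ] at h
    have hb := weightedHamming_lt_one (Fin.tail a) (Fin.tail b)
    have hc := weightedHamming_lt_one (Fin.tail a) (Fin.tail c)
    have hb0 := weightedHamming_nonneg (Fin.tail a) (Fin.tail b)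
    have hc0 := weightedHamming_nonneg (Fin.tail a) (Fin.tail c)
    -- Tail distances lie in `[0, 1)`, so the leading digit can be read off the distance.
    have h0 : (a 0 ≠ b 0 ↔ a 0 ≠ c 0) := by
      by_contra hne
      split_ifs at h <;> first | exact hne (by tauto) | linarith
    have h1 : b 0 = c 0 := by
      revert h0
      cases a 0 <;> cases b 0 <;> cases c 0 <;> simp
    have h2 : Fin.tail b = Fin.tail c := ih (Fin.tail a) (by simp only [h0] at h; linarith)
    rw [← Fin.cons_self_tail b, ← Fin.cons_self_tail c, h1, h2]

/-- Two profiles are closer than `2⁻ʲ` iff their first `j` bits agree. -/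
theorem weightedHamming_lt_iff (a b : Fin k → Bool) (j : ℕ) :
    weightedHamming a b < (1 / 2 : ℝ) ^ j ↔ ∀ i : Fin k, (i : ℕ) < j → a i = b i := by
  induction k generalizing j with
  | zero => simp [weightedHamming]
  | succ k ih =>
    cases j with
    | zero => simpa using weightedHamming_lt_one a b
    | succ j =>
      rw [weightedHamming_succ, Fin.forall_fin_succ, div_lt_iff₀ two_pos]
      have h2 : (1 / 2 : ℝ) ^ (j + 1) * 2 = (1 / 2) ^ j := by ring
      rw [h2]
      by_cases h : a 0 = b 0
      · simpa [h, Fin.tail] using ih (Fin.tail a) (Fin.tail b) j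
      · have h3 := weightedHamming_nonneg (Fin.tail a) (Fin.tail b)
        have h4 : (1 / 2 : ℝ) ^ j ≤ 1 := pow_le_one₀ (by norm_num) (by norm_num)
        simp only [ne_eq, h, not_false_eq_true, if_true, Fin.val_zero, Nat.succ_pos, forall_const,
          false_and, iff_false, not_lt]
        linarith

theorem weightedHamming_lt_iff_prefix {j : ℕ} (h : j ≤ k) (a b : Fin k → Bool) :
    weightedHamming a b < (1 / 2 : ℝ) ^ j ↔ a ∘ Fin.castLE h = b ∘ Fin.castLE h := by
  rw [weightedHamming_lt_iff, funext_iff]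
  exact ⟨fun H i => H _ i.2, fun H i hi => H ⟨i, hi⟩⟩

theorem weightedHamming_lt_iff_eq (a b : Fin k → Bool) :
    weightedHamming a b < (1 / 2 : ℝ) ^ k ↔ a = b := by
  rw [weightedHamming_lt_iff, funext_iff]
  exact ⟨fun H i => H _ i.2, fun H i _ => H i⟩

end WeightedHamming

/-! ### Stable matchings under a symmetric distance. -/

section Stability

variable {n k : ℕ}

theorem personDist_comm (a : Profiles n k) (x y : Person n) :
    personDist a x y = personDist a y x :=
  weightedHamming_comm _ _

theorem Prefers.irrefl (M : Market n k) (x : Person n) (i : Fin n) : ¬ Prefers M x i i := by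
  simp [Prefers]

theorem Prefers.trans {M : Market n k} {x : Person n} {i j l : Fin n}
    (h₁ : Prefers M x i j) (h₂ : Prefers M x j l) : Prefers M x i l := by
  rcases h₁ with h₁ | ⟨h₁, h₁'⟩ <;> rcases h₂ with h₂ | ⟨h₂, h₂'⟩
  · exact Or.inl (h₁.trans h₂)
  · exact Or.inl (h₁.trans_eq h₂)
  · exact Or.inl (h₁.trans_lt h₂)
  · exact Or.inr ⟨h₁.trans h₂, h₁'.trans h₂'⟩

theorem Prefers.total (M : Market n k) (x : Person n) (i j : Fin n)
    (h₁ : ¬ Prefers M x i j) (h₂ : ¬ Prefers M x j i) : i = j := by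
  simp only [Prefers, not_or, not_and, not_lt] at h₁ h₂
  have h := le_antisymm h₁.1 h₂.1
  exact (M.2 x).injective (le_antisymm (h₂.2 h) (h₁.2 h.symm))

theorem Prefers.dist_le {M : Market n k} {x : Person n} {i j : Fin n} (h : Prefers M x i j) :
    personDist M.1 x (opposite x i) ≤ personDist M.1 x (opposite x j) :=
  h.elim le_of_lt fun h => h.1.le

/-- The matching given by a one-to-one relation between men and women. -/
def matchingOfRel (R : Fin n → Fin n → Prop) (h₁ : ∀ a b c, R a b → R a c → b = c)
    (h₂ : ∀ a c b, R a b → R c b → a = c) : Matching n := by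
  classical
  refine
    { toFun := Sum.elim (fun i => if h : ∃ j, R i j then Sum.inr h.choose else Sum.inl i)
        (fun j => if h : ∃ i, R i j then Sum.inl h.choose else Sum.inr j)
      self_or_opposite := ?_
      symm := ?_ }
  · rintro (i | j)
    · by_cases h : ∃ j, R i j
      · exact Or.inr ⟨h.choose, by simp [h, opposite]⟩
      · exact Or.inl (by simp [h])
    · by_cases h : ∃ i, R i j
      · exact Or.inr ⟨h.choose, by simp [h, opposite]⟩
      · exact Or.inl (by simp [h])
  · rintro (i | j) y rfl
    · by_cases h : ∃ j, R i j
      · have h' : ∃ i', R i' h.choose := ⟨i, h.choose_spec⟩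
        simpa [h, h'] using h₂ _ _ _ h'.choose_spec h.choose_spec
      · simp [h]
    · by_cases h : ∃ i, R i j
      · have h' : ∃ j', R h.choose j' := ⟨j, h.choose_spec⟩
        simpa [h, h'] using h₁ _ _ _ h'.choose_spec h.choose_spec
      · simp [h]

theorem matchingOfRel_inl {R : Fin n → Fin n → Prop} (h₁ h₂) {i j : Fin n} (h : R i j) :
    (matchingOfRel R h₁ h₂).toFun (Sum.inl i) = Sum.inr j := by
  have h' : ∃ j, R i j := ⟨j, h⟩
  simpa [matchingOfRel, h'] using h₁ _ _ _ h'.choose_spec h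

theorem exists_isStable (M : Market n k) : ∃ μ : Matching n, IsStable M μ := by
  obtain ⟨R, h₁, h₂, h₃⟩ := exists_stable_relation
    (fun i => Prefers M (Sum.inl i)) (fun j => Prefers M (Sum.inr j))
    (fun i => Prefers.irrefl M _) (fun i _ _ _ => Prefers.trans) (fun i => Prefers.total M _)
    (fun i => Prefers.irrefl M _) (fun i _ _ _ => Prefers.trans) (fun i => Prefers.total M _)
  refine ⟨matchingOfRel R h₁ h₂, fun i j ⟨hi, hj⟩ => h₃ i j (fun c hc => ?_) fun c hc => ?_⟩
  · exact hi c (matchingOfRel_inl h₁ h₂ hc)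
  · exact hj c ((matchingOfRel R h₁ h₂).symm _ _ (matchingOfRel_inl h₁ h₂ hc))

theorem Matching.injective (μ : Matching n) : Function.Injective μ.toFun := fun x y h => by
  rw [← μ.symm x _ rfl, ← μ.symm y _ rfl, h]

/-- A stable matching is perfect. -/
theorem IsStable.exists_perm {M : Market n k} {μ : Matching n} (h : IsStable M μ) :
    ∃ σ : Equiv.Perm (Fin n), ∀ i, μ.toFun (Sum.inl i) = Sum.inr (σ i) := by
  -- An unmatched woman and an unmatched man would block.
  have women : ∀ j, μ.toFun (Sum.inr j) = Sum.inr j →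
      ∀ i, ∃ j', μ.toFun (Sum.inl i) = Sum.inr j' := by
    intro j hj i
    refine (μ.self_or_opposite (Sum.inl i)).resolve_left fun hi => h i j ⟨?_, ?_⟩
    · intro l hl; rw [hi] at hl; cases hl
    · intro l hl; rw [hj] at hl; cases hl
  have men : ∀ i, ∃ j, μ.toFun (Sum.inl i) = Sum.inr j := by
    by_cases H : ∃ j, μ.toFun (Sum.inr j) = Sum.inr j
    · exact women H.choose H.choose_spec
    · push Not at H
      choose g hg using fun j => (μ.self_or_opposite (Sum.inr j)).resolve_left (H j)
      have hinj : Function.Injective g := fun a b hab => by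
        have : μ.toFun (Sum.inr a) = μ.toFun (Sum.inr b) := by rw [hg, hg, hab]; rfl
        exact Sum.inr_injective (μ.injective this)
      intro i
      obtain ⟨j, rfl⟩ := (Finite.injective_iff_surjective.1 hinj) i
      exact ⟨j, μ.symm _ _ (hg j)⟩
  choose f hf using men
  have hinj : Function.Injective f := fun a b hab =>
    Sum.inl_injective (μ.injective ((hf a).trans (by rw [hab, hf])))
  exact ⟨Equiv.ofBijective f (Finite.injective_iff_bijective.1 hinj), hf⟩

theorem IsStable.not_blocking {M : Market n k} {μ : Matching n} (h : IsStable M μ)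
    {σ : Equiv.Perm (Fin n)} (hσ : ∀ i, μ.toFun (Sum.inl i) = Sum.inr (σ i)) (i j : Fin n)
    (hi : Prefers M (Sum.inl i) j (σ i)) : ¬ Prefers M (Sum.inr j) i (σ.symm j) := by
  refine fun hj => h i j ⟨fun l hl => ?_, fun l hl => ?_⟩
  · rw [hσ] at hl
    rwa [← Sum.inr_injective hl]
  · have := μ.symm _ _ hl
    rw [show opposite (Sum.inr j) l = Sum.inl l from rfl, hσ] at this
    rwa [← Sum.inr_injective this, σ.symm_apply_apply, Sum.inr_injective this] at hj

/-- In two stable matchings, the men who prefer the first and the women who prefer the second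
are matched among themselves in both, and with a symmetric distance nobody gains. -/
theorem dist_eq_of_opposite_interests (d : Fin n → Fin n → ℝ) (σ τ : Equiv.Perm (Fin n))
    (A B : Finset (Fin n)) (hσ : ∀ i ∈ A, σ i ∈ B) (hτ : ∀ j ∈ B, τ.symm j ∈ A)
    (hA : ∀ i ∈ A, d i (σ i) ≤ d i (τ i)) (hB : ∀ j ∈ B, d (τ.symm j) j ≤ d (σ.symm j) j) :
    (∀ i ∈ A, d i (σ i) = d i (τ i)) ∧ ∀ j ∈ B, d (τ.symm j) j = d (σ.symm j) j := by
  have hmapσ : A.map σ.toEmbedding ⊆ B := fun x hx => by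
    obtain ⟨i, hi, rfl⟩ := Finset.mem_map.1 hx
    exact hσ i hi
  have hmapτ : B.map τ.symm.toEmbedding ⊆ A := fun x hx => by
    obtain ⟨i, hi, rfl⟩ := Finset.mem_map.1 hx
    exact hτ i hi
  have c1 := Finset.card_le_card hmapσ
  have c2 := Finset.card_le_card hmapτ
  rw [Finset.card_map] at c1 c2
  have e1 : A.map σ.toEmbedding = B := Finset.eq_of_subset_of_card_le hmapσ (by simpa using c2)
  have e2 : B.map τ.symm.toEmbedding = A := Finset.eq_of_subset_of_card_le hmapτ (by simpa using c1)
  -- Both injections between `A` and `B` are bijections, so the two inequalities between sums close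
  -- into a cycle and every term is an equality.
  have s1 : ∑ j ∈ B, d (σ.symm j) j = ∑ i ∈ A, d i (σ i) := by
    conv_lhs => rw [← e1]
    simp
  have s2 : ∑ i ∈ A, d i (τ i) = ∑ j ∈ B, d (τ.symm j) j := by
    conv_lhs => rw [← e2]
    simp
  have l1 := Finset.sum_le_sum hA
  have l2 := Finset.sum_le_sum hB
  exact ⟨(Finset.sum_eq_sum_iff_of_le hA).1 (by linarith),
    (Finset.sum_eq_sum_iff_of_le hB).1 (by linarith)⟩

theorem IsStable.dist_eq {M : Market n k} {μ ν : Matching n} (hμ : IsStable M μ)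
    (hν : IsStable M ν) (x : Person n) :
    personDist M.1 x (μ.toFun x) = personDist M.1 x (ν.toFun x) := by
  classical
  have key : ∀ {μ ν : Matching n} (σ τ : Equiv.Perm (Fin n)), IsStable M μ → IsStable M ν →
      (∀ i, μ.toFun (Sum.inl i) = Sum.inr (σ i)) → (∀ i, ν.toFun (Sum.inl i) = Sum.inr (τ i)) →
      (∀ i, Prefers M (Sum.inl i) (σ i) (τ i) →
        personDist M.1 (Sum.inl i) (Sum.inr (σ i)) = personDist M.1 (Sum.inl i) (Sum.inr (τ i))) ∧
      ∀ j, Prefers M (Sum.inr j) (τ.symm j) (σ.symm j) →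
        personDist M.1 (Sum.inl (τ.symm j)) (Sum.inr j) =
          personDist M.1 (Sum.inl (σ.symm j)) (Sum.inr j) := by
    intro μ ν σ τ hμ hν hσ hτ
    have := dist_eq_of_opposite_interests
      (fun i j => personDist M.1 (Sum.inl i) (Sum.inr j)) σ τ
      (Finset.univ.filter fun i => Prefers M (Sum.inl i) (σ i) (τ i))
      (Finset.univ.filter fun j => Prefers M (Sum.inr j) (τ.symm j) (σ.symm j)) ?_ ?_ ?_ ?_
    · simpa using this
    · intro i hi
      simp only [Finset.mem_filter_univ, Equiv.symm_apply_apply] at hi ⊢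
      -- Stability of `ν` forbids `σ i` from preferring `i` to her `ν`-partner. Were she not to
      -- prefer that partner either, it would be `i`, forcing `σ i = τ i`.
      by_contra hc
      have := Prefers.total _ _ _ _ (hν.not_blocking hτ i (σ i) hi) hc
      rw [Equiv.eq_symm_apply] at this
      exact Prefers.irrefl _ _ _ (this ▸ hi)
    · intro j hj
      simp only [Finset.mem_filter_univ, Equiv.apply_symm_apply] at hj ⊢
      by_contra hc
      have := Prefers.total _ _ _ _ (fun h => hμ.not_blocking hσ (τ.symm j) j h hj) hc
      rw [← Equiv.symm_apply_eq] at this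
      exact Prefers.irrefl _ _ _ (this ▸ hj)
    · intro i hi
      exact (Finset.mem_filter_univ i |>.1 hi).dist_le
    · intro j hj
      have := (Finset.mem_filter_univ j |>.1 hj).dist_le
      simpa only [opposite, personDist_comm M.1 (Sum.inr j)] using this
  obtain ⟨σ, hσ⟩ := hμ.exists_perm
  obtain ⟨τ, hτ⟩ := hν.exists_perm
  have k1 := key σ τ hμ hν hσ hτ
  have k2 := key τ σ hν hμ hτ hσ
  rcases x with i | j
  · rw [hσ, hτ]
    by_cases h1 : Prefers M (Sum.inl i) (σ i) (τ i)
    · exact k1.1 i h1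
    by_cases h2 : Prefers M (Sum.inl i) (τ i) (σ i)
    · exact (k2.1 i h2).symm
    rw [Prefers.total _ _ _ _ h1 h2]
  · have hσ' : μ.toFun (Sum.inr j) = Sum.inl (σ.symm j) := μ.symm _ _ (by simp [hσ])
    have hτ' : ν.toFun (Sum.inr j) = Sum.inl (τ.symm j) := ν.symm _ _ (by simp [hτ])
    rw [hσ', hτ', personDist_comm, personDist_comm M.1 (Sum.inr j)]
    by_cases h1 : Prefers M (Sum.inr j) (τ.symm j) (σ.symm j)
    · exact (k1.2 j h1).symm
    by_cases h2 : Prefers M (Sum.inr j) (σ.symm j) (τ.symm j)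
    · exact k2.2 j h2
    rw [Prefers.total _ _ _ _ h1 h2]

theorem IsStable.personDist_eq_matchingDistance {M : Market n k} {μ : Matching n}
    (h : IsStable M μ) (x : Person n) : personDist M.1 x (μ.toFun x) = matchingDistance M x := by
  have h' : ∃ μ, IsStable M μ := ⟨μ, h⟩
  rw [matchingDistance, dif_pos h']
  exact h.dist_eq h'.choose_spec x

theorem IsStable.apply_ne {M : Market n k} {μ : Matching n} (h : IsStable M μ) (x : Person n) :
    μ.toFun x ≠ x := by
  obtain ⟨σ, hσ⟩ := h.exists_perm
  rcases x with i | j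
  · simp [hσ]
  · have : μ.toFun (Sum.inr j) = Sum.inl (σ.symm j) := μ.symm _ _ (by simp [hσ])
    simp [this]

/-- The partners of `x` in two stable matchings have the same profile. -/
theorem IsStable.profile_eq {M : Market n k} {μ ν : Matching n} (hμ : IsStable M μ)
    (hν : IsStable M ν) (x : Person n) : M.1 (μ.toFun x) = M.1 (ν.toFun x) :=
  weightedHamming_right_injective _ (hμ.dist_eq hν x)

/-- Distinct profiles leave no ties, so stability does not depend on the lists, and partners with
equal profiles are equal. -/
theorem uniqueWithoutTieBreaking_of_injective {a : Profiles n k} (h : Function.Injective a) :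
    UniqueWithoutTieBreaking a := by
  have hp : ∀ (T T' : TieLists n) x i j, Prefers (a, T) x i j → Prefers (a, T') x i j := by
    rintro T T' x i j (h1 | ⟨h1, h2⟩)
    · exact Or.inl h1
    · have h3 := h (weightedHamming_right_injective _ h1)
      have h4 : i = j := by cases x <;> simpa [opposite] using h3
      exact absurd h2 (by simp [h4])
  have hs : ∀ (T T' : TieLists n) ν, IsStable (a, T) ν → IsStable (a, T') ν :=
    fun T T' ν hν i j hb =>
      hν i j ⟨fun l hl => hp T' T _ _ _ (hb.1 l hl), fun l hl => hp T' T _ _ _ (hb.2 l hl)⟩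
  obtain ⟨μ, hμ⟩ := exists_isStable ((a, fun _ => 1) : Market n k)
  refine ⟨μ, fun T ν => ⟨fun hν => ?_, fun hν => hν ▸ hs _ _ _ hμ⟩⟩
  ext x
  exact h ((hs T _ ν hν).profile_eq hμ x)

end Stability

/-! ### Averaging over independent coordinates and Markov's inequality. -/

section Counting

/-- Independence of two coordinates: the one at `x` may be resampled with the one at `y` fixed. -/
theorem sum_apply_apply_mul_card {V B R : Type*} [Fintype V] [DecidableEq V] [Fintype B]
    [CommSemiring R] {x y : V} (h : y ≠ x) (g : B → B → R) :
    (∑ a : V → B, g (a x) (a y)) * Fintype.card B = ∑ a : V → B, ∑ b, g b (a y) := by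
  have e : ∀ F : B → B → R, ∑ a : V → B, F (a x) (a y) =
      ∑ b, ∑ f : {z // z ≠ x} → B, F b (f ⟨y, h⟩) := fun F => by
    rw [← (Equiv.funSplitAt x B).symm.sum_comp, Fintype.sum_prod_type]
    simp [Equiv.funSplitAt, Equiv.piSplitAt, h]
  rw [e g, e fun _ c => ∑ b, g b c, Finset.sum_const, Finset.card_univ, nsmul_eq_mul, mul_comm]
  congr 1
  exact Finset.sum_comm

theorem sum_prefix_eq_mul {j k : ℕ} (h : j ≤ k) (β : Fin j → Bool) :
    (∑ b : Fin k → Bool, if b ∘ Fin.castLE h = β then (1 : ℝ) else 0) * 2 ^ j = 2 ^ k := by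
  obtain ⟨l, rfl⟩ := Nat.exists_eq_add_of_le h
  rw [← (Fin.appendEquiv j l).sum_comp, Fintype.sum_prod_type]
  have : ∀ (p : Fin j → Bool) (q : Fin l → Bool),
      (Fin.appendEquiv j l (p, q)) ∘ Fin.castLE h = p := fun p q => by
    funext i
    exact Fin.append_left p q i
  simp only [this]
  simp [pow_add, mul_comm]

/-- Markov's inequality: `f` dominates the indicator of the complement of `A`. -/
theorem one_sub_div_le_uniformProb {Ω : Type} [Fintype Ω] [Nonempty Ω] (A : Set Ω) (f : Ω → ℝ)
    (h0 : ∀ ω, 0 ≤ f ω) (h1 : ∀ ω, ω ∉ A → 1 ≤ f ω) :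
    1 - (∑ ω, f ω) / Fintype.card Ω ≤ uniformProb A := by
  classical
  have hc : (0 : ℝ) < Fintype.card Ω := by exact_mod_cast Fintype.card_pos
  rw [uniformProb, Nat.card_eq_fintype_card, sub_le_iff_le_add, ← add_div, le_div_iff₀ hc, one_mul]
  have h2 : (A.ncard : ℝ) = ∑ ω, if ω ∈ A then 1 else 0 := by
    rw [Set.ncard_eq_toFinset_card', ← Set.filter_mem_univ_eq_toFinset]
    simp
  rw [h2, ← Finset.sum_add_distrib]
  calc (Fintype.card Ω : ℝ) = ∑ _ω : Ω, (1 : ℝ) := by simp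
    _ ≤ _ := Finset.sum_le_sum fun ω _ => by
      by_cases h : ω ∈ A
      · simpa [h] using h0 ω
      · simpa [h] using h1 ω h

theorem uniformProb_le_one {Ω : Type} [Finite Ω] (A : Set Ω) : uniformProb A ≤ 1 := by
  refine div_le_one_of_le₀ ?_ (Nat.cast_nonneg _)
  exact_mod_cast Set.ncard_le_card A

end Counting

/-! ### Close pairs of random profiles. -/

section RandomProfiles

variable {n k : ℕ}

/-- The number of ordered pairs of distinct participants at distance less than `2⁻ʲ`. -/
def closePairs (j : ℕ) (a : Profiles n k) : ℝ :=
  ∑ x, ∑ y ∈ Finset.univ.erase x, if personDist a x y < (1 / 2 : ℝ) ^ j then 1 else 0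

theorem closePairs_nonneg (j : ℕ) (a : Profiles n k) : 0 ≤ closePairs j a :=
  Finset.sum_nonneg fun _ _ => Finset.sum_nonneg fun _ _ => by split_ifs <;> norm_num

theorem sum_ite_personDist_lt {j : ℕ} (hj : j ≤ k) {x y : Person n} (h : y ≠ x) :
    ∑ a : Profiles n k, (if personDist a x y < (1 / 2 : ℝ) ^ j then (1 : ℝ) else 0) =
      Fintype.card (Profiles n k) / 2 ^ j := by
  have key := sum_apply_apply_mul_card (R := ℝ) h
    (fun b c : Fin k → Bool => if weightedHamming b c < (1 / 2 : ℝ) ^ j then 1 else 0)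
  have h2 : ∀ c : Fin k → Bool, (∑ b, if weightedHamming b c < (1 / 2 : ℝ) ^ j then (1 : ℝ) else 0) =
      2 ^ k / 2 ^ j := fun c => by
    rw [eq_div_iff (by positivity), ← sum_prefix_eq_mul hj (c ∘ Fin.castLE hj)]
    simp only [weightedHamming_lt_iff_prefix hj]
  simp only [h2, Finset.sum_const, Finset.card_univ, nsmul_eq_mul] at key
  have hc : ((Fintype.card (Fin k → Bool) : ℕ) : ℝ) = 2 ^ k := by simp
  rw [hc] at key
  have h3 : (2 : ℝ) ^ k ≠ 0 := by positivity
  rw [← mul_left_inj' h3]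
  refine Eq.trans ?_ (key.trans ?_)
  · rfl
  · ring

theorem sum_closePairs_le {j : ℕ} (hj : j ≤ k) :
    ∑ a : Profiles n k, closePairs j a ≤ (2 * n) ^ 2 / 2 ^ j * Fintype.card (Profiles n k) := by
  simp only [closePairs]
  rw [Finset.sum_comm]
  have : ∀ x : Person n, ∑ a : Profiles n k, ∑ y ∈ Finset.univ.erase x,
      (if personDist a x y < (1 / 2 : ℝ) ^ j then (1 : ℝ) else 0) ≤
        (2 * n) * (Fintype.card (Profiles n k) / 2 ^ j) := fun x => by
    rw [Finset.sum_comm, Finset.sum_congr rfl fun y hy =>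
      sum_ite_personDist_lt hj (Finset.ne_of_mem_erase hy), Finset.sum_const, nsmul_eq_mul]
    refine mul_le_mul_of_nonneg_right ?_ (by positivity)
    have : (Finset.univ.erase x).card ≤ Fintype.card (Person n) := Finset.card_erase_le
    rw [Fintype.card_sum, Fintype.card_fin] at this
    calc ((Finset.univ.erase x).card : ℝ) ≤ ((n + n : ℕ) : ℝ) := by exact_mod_cast this
      _ = 2 * n := by push_cast; ring
  refine (Finset.sum_le_sum fun x _ => this x).trans (le_of_eq ?_)
  simp only [Finset.sum_const, Finset.card_univ, Fintype.card_sum, Fintype.card_fin, nsmul_eq_mul]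
  push_cast
  ring

theorem one_le_closePairs {a : Profiles n k} (h : ¬ Function.Injective a) :
    1 ≤ closePairs k a := by
  simp only [Function.Injective, not_forall] at h
  obtain ⟨x, y, hxy, hne⟩ := h
  have h0 : ∀ x y : Person n, (0 : ℝ) ≤ if personDist a x y < (1 / 2 : ℝ) ^ k then 1 else 0 :=
    fun x y => by split_ifs <;> norm_num
  refine le_trans ?_ (Finset.single_le_sum (fun z _ => Finset.sum_nonneg fun y _ => h0 z y)
    (Finset.mem_univ x))
  refine le_trans ?_ (Finset.single_le_sum (fun z _ => h0 x z)
    (Finset.mem_erase.2 ⟨Ne.symm hne, Finset.mem_univ y⟩))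
  exact (if_pos ((weightedHamming_lt_iff_eq _ _).2 hxy)).ge

theorem card_le_closePairs (j : ℕ) (a : Profiles n k) (S : Finset (Person n))
    (hS : ∀ x ∈ S, ∃ y, y ≠ x ∧ personDist a x y < (1 / 2 : ℝ) ^ j) :
    (S.card : ℝ) ≤ closePairs j a := by
  have h0 : ∀ x y : Person n, (0 : ℝ) ≤ if personDist a x y < (1 / 2 : ℝ) ^ j then 1 else 0 :=
    fun x y => by split_ifs <;> norm_num
  rw [closePairs]
  refine le_trans ?_ (Finset.sum_le_sum_of_subset_of_nonneg (Finset.subset_univ S)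
    fun x _ _ => Finset.sum_nonneg fun y _ => h0 x y)
  rw [Finset.card_eq_sum_ones, Nat.cast_sum]
  refine Finset.sum_le_sum fun x hx => ?_
  obtain ⟨y, hy, hd⟩ := hS x hx
  refine le_trans ?_ (Finset.single_le_sum (fun z _ => h0 x z)
    (Finset.mem_erase.2 ⟨hy, Finset.mem_univ y⟩))
  rw [if_pos hd, Nat.cast_one]

/-- For `x` with several stable partners, the partner under one fixed stable matching shares its
profile with another of them. These partners are distinct for distinct `x`, so they are counted in
place of `x`. -/
theorem multipleFraction_le_closePairs (M : Market n k) :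
    multipleFraction M ≤ closePairs k M.1 / (2 * n) := by
  classical
  obtain ⟨μ, hμ⟩ := exists_isStable M
  refine div_le_div_of_nonneg_right ?_ (by positivity)
  rw [Set.ncard_eq_toFinset_card', ← Finset.card_image_of_injective _ μ.injective]
  refine card_le_closePairs _ _ _ fun z hz => ?_
  obtain ⟨x, hx, rfl⟩ := Finset.mem_image.1 hz
  rw [Set.mem_toFinset] at hx
  have hx : (stablePartners M x).Nontrivial := hx
  obtain ⟨j, ⟨ν, hν, hj⟩, hne⟩ : ∃ j ∈ stablePartners M x, opposite x j ≠ μ.toFun x := by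
    obtain ⟨i, hi, j, hj, hij⟩ := hx
    by_cases h : opposite x i = μ.toFun x
    · refine ⟨j, hj, fun h' => hij ?_⟩
      have := h.trans h'.symm
      cases x <;> simpa [opposite] using this
    · exact ⟨i, hi, h⟩
  exact ⟨_, hne, (weightedHamming_lt_iff_eq _ _).2 (hj ▸ hμ.profile_eq hν x)⟩

theorem card_matchingDistance_lt_le (j : ℕ) (M : Market n k) :
    (((Finset.univ.filter fun x => matchingDistance M x < (1 / 2 : ℝ) ^ j).card : ℕ) : ℝ) ≤
      closePairs j M.1 := by
  obtain ⟨μ, hμ⟩ := exists_isStable M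
  refine card_le_closePairs _ _ _ fun x hx => ⟨μ.toFun x, hμ.apply_ne x, ?_⟩
  rw [hμ.personDist_eq_matchingDistance]
  exact (Finset.mem_filter.1 hx).2

/-! ### Imbalance between the sides in a subcube. -/

/-- `1` for men and `-1` for women. -/
def sideSign : Person n → ℝ := Sum.elim (fun _ => 1) fun _ => -1

/-- The number of men minus the number of women whose profile begins with `β`. -/
def imbalance {j : ℕ} (h : j ≤ k) (a : Profiles n k) (β : Fin j → Bool) : ℝ :=
  ∑ x, if a x ∘ Fin.castLE h = β then sideSign x else 0

theorem sum_imbalance_sq {j : ℕ} (h : j ≤ k) (a : Profiles n k) :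
    ∑ β, imbalance h a β ^ 2 = ∑ x, ∑ y, sideSign x * sideSign y *
      if personDist a x y < (1 / 2 : ℝ) ^ j then 1 else 0 := by
  simp only [imbalance, sq, Finset.sum_mul_sum]
  rw [Finset.sum_comm]
  refine Finset.sum_congr rfl fun x _ => ?_
  rw [Finset.sum_comm]
  refine Finset.sum_congr rfl fun y _ => ?_
  simp only [personDist, weightedHamming_lt_iff_prefix h]
  simp [eq_comm]

/-- The expected close-pair indicator is the constant `2⁻ʲ` off the diagonal, and the signs sum to
zero, so only a diagonal contribution `2n(1 - 2⁻ʲ)` survives on average. -/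
theorem sum_sum_imbalance_sq_le {j : ℕ} (h : j ≤ k) :
    ∑ a : Profiles n k, ∑ β, imbalance h a β ^ 2 ≤ 2 * n * Fintype.card (Profiles n k) := by
  set N : ℝ := ((Fintype.card (Profiles n k) : ℕ) : ℝ) with hN
  have hs : ∀ x : Person n, sideSign x * sideSign x = 1 := by
    rintro (i | i) <;> simp [sideSign]
  have h0 : ∀ x y : Person n, ∑ a : Profiles n k, sideSign x * sideSign y *
      (if personDist a x y < (1 / 2 : ℝ) ^ j then (1 : ℝ) else 0) =
      sideSign x * sideSign y * (N / 2 ^ j) + if x = y then N - N / 2 ^ j else 0 := by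
    intro x y
    rw [← Finset.mul_sum]
    by_cases hxy : x = y
    · subst hxy
      have : ∀ a : Profiles n k, personDist a x x < (1 / 2 : ℝ) ^ j := fun a =>
        (weightedHamming_lt_iff _ _ _).2 fun _ _ => rfl
      simp only [this, if_true, hs, Finset.sum_const, Finset.card_univ, nsmul_eq_mul, one_mul,
        mul_one, ← hN]
      ring
    · rw [sum_ite_personDist_lt h (Ne.symm hxy), if_neg hxy, add_zero]
  have h1 : ∑ x : Person n, sideSign x = 0 := by simp [sideSign, Fintype.sum_sum_type]
  have h3 : ∑ a : Profiles n k, ∑ β, imbalance h a β ^ 2 = ∑ x : Person n, ∑ y : Person n,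
      (sideSign x * sideSign y * (N / 2 ^ j) + if x = y then N - N / 2 ^ j else 0) := by
    simp only [sum_imbalance_sq, ← h0]
    rw [Finset.sum_comm]
    exact Finset.sum_congr rfl fun x _ => Finset.sum_comm
  simp only [h3, Finset.sum_add_distrib, mul_assoc, ← Finset.mul_sum, ← Finset.sum_mul, h1]
  simp only [zero_mul, mul_zero, Finset.sum_ite_eq, Finset.mem_univ, if_true, Finset.sum_const,
    Finset.card_univ, Fintype.card_sum, Fintype.card_fin, nsmul_eq_mul, zero_add]
  have h2 : 0 ≤ N / 2 ^ j := by positivity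
  push_cast
  nlinarith [(Nat.cast_nonneg n : (0 : ℝ) ≤ n), mul_nonneg (Nat.cast_nonneg n : (0 : ℝ) ≤ n) h2]

/-- A man and a woman closer to each other than to their partners would block. -/
theorem IsStable.sideSign_eq_of_le {M : Market n k} {μ : Matching n} (hμ : IsStable M μ)
    {x y : Person n} (hx : personDist M.1 x y < personDist M.1 x (μ.toFun x))
    (hy : personDist M.1 x y < personDist M.1 y (μ.toFun y)) : sideSign x = sideSign y := by
  have key : ∀ i j, personDist M.1 (Sum.inl i) (Sum.inr j) <
      personDist M.1 (Sum.inl i) (μ.toFun (Sum.inl i)) →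
      ¬ personDist M.1 (Sum.inl i) (Sum.inr j) <
        personDist M.1 (Sum.inr j) (μ.toFun (Sum.inr j)) := by
    refine fun i j hi hj => hμ i j ⟨fun l hl => Or.inl ?_, fun l hl => Or.inl ?_⟩
    · rwa [← hl]
    · rw [← hl, personDist_comm M.1 _ (opposite _ _)]
      exact hj
  rcases x with i | i <;> rcases y with j | j
  · rfl
  · exact absurd hy (key i j hx)
  · rw [personDist_comm] at hx hy
    exact absurd hx (key j i hy)
  · rfl

theorem card_far_le_abs_imbalance {j : ℕ} (h : j ≤ k) (M : Market n k) (β : Fin j → Bool) :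
    (((Finset.univ.filter fun x => (1 / 2 : ℝ) ^ j ≤ matchingDistance M x ∧
      M.1 x ∘ Fin.castLE h = β).card : ℕ) : ℝ) ≤ |imbalance h M.1 β| := by
  obtain ⟨μ, hμ⟩ := exists_isStable M
  have hsplit : imbalance h M.1 β =
      ∑ x ∈ Finset.univ.filter (fun x => (1 / 2 : ℝ) ^ j ≤ matchingDistance M x ∧
        M.1 x ∘ Fin.castLE h = β), sideSign x +
      ∑ x ∈ Finset.univ.filter (fun x => ¬ (1 / 2 : ℝ) ^ j ≤ matchingDistance M x ∧
        M.1 x ∘ Fin.castLE h = β), sideSign x := by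
    rw [imbalance, Finset.sum_filter, Finset.sum_filter, ← Finset.sum_add_distrib]
    refine Finset.sum_congr rfl fun x _ => ?_
    by_cases h1 : (1 / 2 : ℝ) ^ j ≤ matchingDistance M x <;> simp only [h1, not_true_eq_false, not_false_eq_true,
      true_and, false_and, if_false, add_zero, zero_add]
  have hnear : ∑ x ∈ Finset.univ.filter (fun x => ¬ (1 / 2 : ℝ) ^ j ≤ matchingDistance M x ∧
        M.1 x ∘ Fin.castLE h = β), sideSign x = 0 := by
    -- Partners at distance below `2⁻ʲ` share the prefix `β` and have opposite signs, so they
    -- cancel.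
    refine Finset.sum_involution (fun x _ => μ.toFun x) (fun x _ => ?_)
      (fun x _ _ => hμ.apply_ne x) (fun x hx => ?_) fun x _ => μ.symm _ _ rfl
    · obtain ⟨i, hi⟩ := (μ.self_or_opposite x).resolve_left (hμ.apply_ne x)
      rw [hi]
      cases x <;> simp [opposite, sideSign]
    · simp only [Finset.mem_filter_univ, not_le, ← hμ.personDist_eq_matchingDistance] at hx ⊢
      rw [μ.symm _ _ rfl, personDist_comm]
      exact ⟨hx.1, ((weightedHamming_lt_iff_prefix h _ _).1 hx.1).symm.trans hx.2⟩
  rw [hsplit, hnear, add_zero]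
  set F := Finset.univ.filter (fun x => (1 / 2 : ℝ) ^ j ≤ matchingDistance M x ∧
        M.1 x ∘ Fin.castLE h = β) with hF
  rcases F.eq_empty_or_nonempty with he | ⟨x, hx⟩
  · simp [he]
  have hconst : ∀ y ∈ F, sideSign y = sideSign x := fun y hy => by
    simp only [hF, Finset.mem_filter_univ, ← hμ.personDist_eq_matchingDistance] at hx hy
    have hd : personDist M.1 y x < (1 / 2 : ℝ) ^ j :=
      (weightedHamming_lt_iff_prefix h _ _).2 (hy.2.trans hx.2.symm)
    exact hμ.sideSign_eq_of_le (hd.trans_le hy.1) (hd.trans_le hx.1)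
  have hone : |(sideSign x : ℝ)| = 1 := by cases x <;> simp [sideSign]
  rw [Finset.sum_congr rfl hconst, Finset.sum_const, nsmul_eq_mul, abs_mul, hone, mul_one,
    Nat.abs_cast]

/-- Summing over the `2^j` prefixes with `|t| ≤ (c + t² / c) / 2` replaces the absolute imbalance by
its square; `c` is optimized later. -/
theorem card_le_matchingDistance_le {j : ℕ} (h : j ≤ k) (M : Market n k) {c : ℝ} (hc : 0 < c) :
    (((Finset.univ.filter fun x => (1 / 2 : ℝ) ^ j ≤ matchingDistance M x).card : ℕ) : ℝ) ≤
      (2 ^ j * c + (∑ β, imbalance h M.1 β ^ 2) / c) / 2 := by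
  rw [Finset.card_eq_sum_card_fiberwise (f := fun x => M.1 x ∘ Fin.castLE h) (t := Finset.univ)
    (fun _ _ => by simp)]
  push_cast
  simp only [Finset.filter_filter]
  have h1 : ∀ β : Fin j → Bool, |imbalance h M.1 β| ≤ (c + imbalance h M.1 β ^ 2 / c) / 2 := by
    intro β
    rw [le_div_iff₀ two_pos, ← sub_le_iff_le_add', le_div_iff₀ hc, ← sq_abs]
    nlinarith [sq_nonneg (|imbalance h M.1 β| - c)]
  refine (Finset.sum_le_sum fun β _ => (card_far_le_abs_imbalance h M β).trans (h1 β)).trans ?_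
  rw [← Finset.sum_div, Finset.sum_add_distrib, ← Finset.sum_div]
  simp

/-! ### Probability bounds for fixed `n` and `k`. -/

theorem sum_market_fst (f : Profiles n k → ℝ) :
    ∑ M : Market n k, f M.1 = Fintype.card (TieLists n) * ∑ a, f a := by
  rw [Fintype.sum_prod_type, Finset.mul_sum]
  simp

theorem sum_market_fst_div_card (f : Profiles n k → ℝ) :
    (∑ M : Market n k, f M.1) / Fintype.card (Market n k) =
      (∑ a, f a) / Fintype.card (Profiles n k) := by
  rw [sum_market_fst, Fintype.card_prod, Nat.cast_mul, mul_comm (Fintype.card (Profiles n k) : ℝ),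
    mul_div_mul_left _ _ (by positivity)]

theorem one_sub_le_uniformProb_multipleFraction (hn : 0 < n) {δ : ℝ} (hδ : 0 < δ) :
    1 - 2 * n / 2 ^ k / δ ≤ uniformProb {M : Market n k | multipleFraction M < δ} := by
  have hn' : (0 : ℝ) < n := by exact_mod_cast hn
  have hc : (0 : ℝ) < Fintype.card (Profiles n k) := by positivity
  refine le_trans ?_ (one_sub_div_le_uniformProb _
    (fun M => closePairs k M.1 / (2 * n * δ)) (fun M => ?_) fun M hM => ?_)
  · rw [sum_market_fst_div_card fun a => closePairs k a / (2 * n * δ), ← Finset.sum_div,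
      div_right_comm (∑ a, closePairs k a)]
    refine sub_le_sub_left ((div_le_div_of_nonneg_right (div_le_div_of_nonneg_right
      (sum_closePairs_le (n := n) (le_refl k)) hc.le) (by positivity)).trans (le_of_eq ?_)) 1
    field_simp
  · exact div_nonneg (closePairs_nonneg _ _) (by positivity)
  · rw [← div_div, one_le_div₀ hδ]
    exact (not_lt.1 hM).trans (multipleFraction_le_closePairs M)

theorem one_sub_le_uniformProb_uniqueWithoutTieBreaking :
    1 - (2 * n) ^ 2 / 2 ^ k ≤ uniformProb {M : Market n k | UniqueWithoutTieBreaking M.1} := by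
  have hc : (0 : ℝ) < Fintype.card (Profiles n k) := by positivity
  refine le_trans ?_ (one_sub_div_le_uniformProb _ (fun M => closePairs k M.1)
    (fun M => closePairs_nonneg _ _) fun M hM => ?_)
  · rw [sum_market_fst_div_card (closePairs k)]
    refine sub_le_sub_left ?_ 1
    rw [div_le_iff₀ hc]
    exact sum_closePairs_le le_rfl
  · exact one_le_closePairs fun h => hM (uniqueWithoutTieBreaking_of_injective h)

theorem one_sub_le_uniformProb_matchingDistance (hn : 0 < n) {i j : ℕ} (hi : i ≤ k) (hj : j ≤ k)
    {c : ℝ} (hc : 0 < c) :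
    1 - (2 * n / 2 ^ i + 2 ^ j * c / (4 * n) + 1 / (2 * c)) ≤
      uniformProb {p : Market n k × Person n |
        (1 / 2 : ℝ) ^ i ≤ matchingDistance p.1 p.2 ∧ matchingDistance p.1 p.2 < (1 / 2) ^ j} := by
  have hn' : (0 : ℝ) < n := by exact_mod_cast hn
  have : Nonempty (Person n) := ⟨Sum.inl ⟨0, hn⟩⟩
  have hP : (0 : ℝ) < Fintype.card (Profiles n k) := by positivity
  refine le_trans ?_ (one_sub_div_le_uniformProb _
    (fun p => (if matchingDistance p.1 p.2 < (1 / 2 : ℝ) ^ i then 1 else 0) +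
      if (1 / 2 : ℝ) ^ j ≤ matchingDistance p.1 p.2 then 1 else 0) (fun p => ?_) fun p hp => ?_)
  · refine sub_le_sub_left ?_ 1
    have hM : ∀ M : Market n k, ∑ x, ((if matchingDistance M x < (1 / 2 : ℝ) ^ i then 1 else 0) +
        if (1 / 2 : ℝ) ^ j ≤ matchingDistance M x then 1 else 0) ≤
        closePairs i M.1 + (2 ^ j * c + (∑ β, imbalance hj M.1 β ^ 2) / c) / 2 := fun M => by
      rw [Finset.sum_add_distrib, Finset.sum_boole, Finset.sum_boole]
      exact add_le_add (card_matchingDistance_lt_le i M) (card_le_matchingDistance_le hj M hc)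
    have hcard : (Fintype.card (Market n k × Person n) : ℝ) =
        Fintype.card (Market n k) * (2 * n) := by
      rw [Fintype.card_prod, Fintype.card_sum, Fintype.card_fin]
      push_cast
      ring
    rw [Fintype.sum_prod_type, hcard, ← div_div, div_le_iff₀ (by positivity)]
    refine (div_le_div_of_nonneg_right (Finset.sum_le_sum fun M _ => hM M)
      (by positivity)).trans ?_
    rw [sum_market_fst_div_card fun a =>
      closePairs i a + (2 ^ j * c + (∑ β, imbalance hj a β ^ 2) / c) / 2, div_le_iff₀ hP,
      Finset.sum_add_distrib, ← Finset.sum_div, Finset.sum_add_distrib, ← Finset.sum_div]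
    refine (add_le_add (sum_closePairs_le hi) (div_le_div_of_nonneg_right (add_le_add_right
      (div_le_div_of_nonneg_right (sum_sum_imbalance_sq_le hj) hc.le) _) two_pos.le)).trans
        (le_of_eq ?_)
    rw [Finset.sum_const, Finset.card_univ, nsmul_eq_mul]
    field_simp
    ring
  · split_ifs <;> norm_num
  · by_cases h1 : matchingDistance p.1 p.2 < (1 / 2 : ℝ) ^ i
    · rw [if_pos h1]
      split_ifs <;> norm_num
    · have h2 : (1 / 2 : ℝ) ^ j ≤ matchingDistance p.1 p.2 :=
        not_lt.1 fun h => hp ⟨not_lt.1 h1, h⟩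
      rw [if_neg h1, if_pos h2, zero_add]

end RandomProfiles

/-! ### Passage to the limit. -/

section Asymptotics

theorem tendsto_uniformProb_one {Ω : ℕ → Type} [∀ n, Finite (Ω n)] (A : ∀ n, Set (Ω n))
    {C η : ℝ} (hη : 0 < η)
    (h : ∀ᶠ n : ℕ in atTop, 1 - C * (n : ℝ) ^ (-η) ≤ uniformProb (A n)) :
    Tendsto (fun n => uniformProb (A n)) atTop (𝓝 1) := by
  refine tendsto_of_tendsto_of_tendsto_of_le_of_le' ?_ tendsto_const_nhds h
    (Eventually.of_forall fun n => uniformProb_le_one _)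
  have := (((tendsto_rpow_neg_atTop hη).comp tendsto_natCast_atTop_atTop).const_mul C).const_sub 1
  simpa using this

theorem rpow_lt_two_pow {x y : ℝ} {m : ℕ} (hx : 0 < x) (h : y * Real.logb 2 x < m) :
    x ^ y < (2 : ℝ) ^ m := by
  rwa [← Real.logb_rpow_eq_mul_logb_of_pos hx, Real.logb_lt_iff_lt_rpow one_lt_two (by positivity),
    Real.rpow_natCast] at h

theorem rpow_le_two_pow {x y : ℝ} {m : ℕ} (hx : 0 < x) (h : y * Real.logb 2 x ≤ m) :
    x ^ y ≤ (2 : ℝ) ^ m := by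
  rwa [← Real.logb_rpow_eq_mul_logb_of_pos hx, Real.logb_le_iff_le_rpow one_lt_two (by positivity),
    Real.rpow_natCast] at h

theorem two_pow_le_rpow {x y : ℝ} {m : ℕ} (hx : 0 < x) (h : (m : ℝ) ≤ y * Real.logb 2 x) :
    (2 : ℝ) ^ m ≤ x ^ y := by
  rwa [← Real.logb_rpow_eq_mul_logb_of_pos hx, Real.le_logb_iff_rpow_le one_lt_two (by positivity),
    Real.rpow_natCast] at h

theorem abs_log_div_log_add_one_le {x X η : ℝ} (hx : 1 < x) (h₁ : x ^ (-(1 + η)) ≤ X)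
    (h₂ : X ≤ x ^ (-(1 - η))) : |Real.log X / Real.log x - (-1)| ≤ η := by
  have hx0 : 0 < x := one_pos.trans hx
  have hX : 0 < X := (Real.rpow_pos_of_pos hx0 _).trans_le h₁
  have hl := Real.log_pos hx
  have l1 := Real.log_le_log (Real.rpow_pos_of_pos hx0 _) h₁
  have l2 := Real.log_le_log hX h₂
  rw [Real.log_rpow hx0] at l1 l2
  rw [abs_le]
  have e1 := (le_div_iff₀ hl).2 l1
  have e2 := (div_le_iff₀ hl).2 l2
  constructor <;> linarith

theorem tendsto_uniformProb_multipleFraction {ε : ℝ} (hε : 0 < ε) {k : ℕ → ℕ}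
    (hk : ∀ᶠ n : ℕ in atTop, (1 + ε) * Real.logb 2 (n : ℝ) < (k n : ℝ)) {δ : ℝ} (hδ : 0 < δ) :
    Tendsto (fun n : ℕ => uniformProb {M : Market n (k n) | multipleFraction M < δ})
      atTop (𝓝 1) := by
  refine tendsto_uniformProb_one _ (C := 2 / δ) hε ?_
  filter_upwards [hk, eventually_gt_atTop 0] with n hkn hn
  refine le_trans ?_ (one_sub_le_uniformProb_multipleFraction hn hδ)
  have hn' : (0 : ℝ) < n := by exact_mod_cast hn
  have h := rpow_lt_two_pow hn' hkn
  rw [Real.rpow_add hn', Real.rpow_one] at h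
  rw [Real.rpow_neg hn'.le, sub_le_sub_iff_left, div_le_iff₀ hδ, div_le_iff₀ (by positivity)]
  have hp : (0 : ℝ) < (n : ℝ) ^ ε := by positivity
  calc (2 : ℝ) * n = 2 / δ * ((n : ℝ) ^ ε)⁻¹ * δ * (n * (n : ℝ) ^ ε) := by field_simp
    _ ≤ _ := by gcongr

theorem tendsto_uniformProb_uniqueWithoutTieBreaking {ε : ℝ} (hε : 0 < ε) {k : ℕ → ℕ}
    (hk : ∀ᶠ n : ℕ in atTop, (2 + ε) * Real.logb 2 (n : ℝ) < (k n : ℝ)) :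
    Tendsto (fun n : ℕ => uniformProb {M : Market n (k n) | UniqueWithoutTieBreaking M.1})
      atTop (𝓝 1) := by
  refine tendsto_uniformProb_one _ (C := 4) hε ?_
  filter_upwards [hk, eventually_gt_atTop 0] with n hkn hn
  refine le_trans ?_ one_sub_le_uniformProb_uniqueWithoutTieBreaking
  have hn' : (0 : ℝ) < n := by exact_mod_cast hn
  have h := rpow_lt_two_pow hn' hkn
  rw [Real.rpow_add hn', Real.rpow_two] at h
  rw [Real.rpow_neg hn'.le, sub_le_sub_iff_left, div_le_iff₀ (by positivity)]
  have hp : (0 : ℝ) < (n : ℝ) ^ ε := by positivity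
  calc (2 * (n : ℝ)) ^ 2 = 4 * ((n : ℝ) ^ ε)⁻¹ * (n ^ 2 * (n : ℝ) ^ ε) := by field_simp; ring
    _ ≤ _ := by gcongr

/-- The base of the logarithm cancels in the ratio. Positivity is required separately because
`Real.log 0 = 0`. -/
theorem tendsto_uniformProb_matchingDistance {ε : ℝ} (hε : 0 < ε) {k : ℕ → ℕ}
    (hk : ∀ᶠ n : ℕ in atTop, (1 + ε) * Real.logb 2 (n : ℝ) < (k n : ℝ)) {δ : ℝ} (hδ : 0 < δ) :
    Tendsto (fun n : ℕ => uniformProb {p : Market n (k n) × Person n |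
        0 < matchingDistance p.1 p.2 ∧
        |Real.log (matchingDistance p.1 p.2) / Real.log (n : ℝ) - (-1)| < δ})
      atTop (𝓝 1) := by
  obtain ⟨η, hη, hη1, hηε, hηδ⟩ : ∃ η : ℝ, 0 < η ∧ η < 1 ∧ η ≤ ε ∧ η < δ := by
    refine ⟨min (1 / 2) (min ε (δ / 2)), by positivity, ?_, ?_, ?_⟩
    · exact (min_le_left _ _).trans_lt (by norm_num)
    · exact (min_le_right _ _).trans (min_le_left _ _)
    · exact ((min_le_right _ _).trans (min_le_right _ _)).trans_lt (by linarith)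
  refine tendsto_uniformProb_one _ (C := 5) (half_pos hη) ?_
  have hlog : Tendsto (fun n : ℕ => Real.logb 2 (n : ℝ)) atTop atTop :=
    (Real.tendsto_logb_atTop one_lt_two).comp tendsto_natCast_atTop_atTop
  filter_upwards [hk, eventually_gt_atTop 1, hlog.eventually_ge_atTop (1 / (2 * η))]
    with n hkn hn hL
  have hn1 : (1 : ℝ) < n := by exact_mod_cast hn
  have hn' : (0 : ℝ) < n := one_pos.trans hn1
  set L := Real.logb 2 (n : ℝ) with hLdef
  have hL0 : 0 < L := lt_of_lt_of_le (by positivity) hL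
  rw [div_le_iff₀ (by positivity)] at hL
  set i := ⌊(1 + η) * L⌋₊
  set j := ⌈(1 - η) * L⌉₊
  have hi1 : (i : ℝ) ≤ (1 + η) * L := Nat.floor_le (by positivity)
  have hi2 : (1 + η) * L < (i + 1 : ℕ) := by exact_mod_cast Nat.lt_floor_add_one _
  have hj1 : (1 - η) * L ≤ j := Nat.le_ceil _
  have hj2 : (j : ℝ) < (1 - η) * L + 1 :=
    Nat.ceil_lt_add_one (mul_nonneg (by linarith) hL0.le)
  have hηL : η * L ≤ ε * L := by gcongr
  have hi : i ≤ k n := by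
    have : (i : ℝ) < k n := by linarith
    exact_mod_cast this.le
  -- The condition `L ≥ 1 / (2η)` absorbs the rounding: `(1 - η)L + 1 ≤ (1 + η)L`.
  have hj : j ≤ k n := by
    have : (j : ℝ) < k n := by linarith
    exact_mod_cast this.le
  have i1 := two_pow_le_rpow hn' hi1
  have i2 := rpow_lt_two_pow hn' hi2
  have j1 := rpow_le_two_pow hn' hj1
  have j2 : (2 : ℝ) ^ j ≤ 2 * (n : ℝ) ^ (1 - η) := by
    have : (j : ℝ) ≤ (1 - η + 1 / L) * L := by
      rw [add_mul, one_div_mul_cancel hL0.ne']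
      exact hj2.le
    refine (two_pow_le_rpow hn' this).trans (le_of_eq ?_)
    rw [Real.rpow_add hn', mul_comm]
    congr 1
    -- Rounding up costs a factor `n^(1/L) = 2`.
    rw [hLdef, one_div, Real.inv_logb, Real.rpow_logb hn' hn1.ne' two_pos]
  have hsub : {p : Market n (k n) × Person n | (1 / 2 : ℝ) ^ i ≤ matchingDistance p.1 p.2 ∧
      matchingDistance p.1 p.2 < (1 / 2) ^ j} ⊆ {p : Market n (k n) × Person n |
        0 < matchingDistance p.1 p.2 ∧
        |Real.log (matchingDistance p.1 p.2) / Real.log (n : ℝ) - (-1)| < δ} := by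
    rintro p ⟨h1, h2⟩
    refine ⟨lt_of_lt_of_le (by positivity) h1,
      (abs_log_div_log_add_one_le hn1 (h1.trans' ?_) (h2.le.trans ?_)).trans_lt hηδ⟩
    · rw [Real.rpow_neg hn'.le, one_div, inv_pow]
      exact inv_anti₀ (by positivity) i1
    · rw [Real.rpow_neg hn'.le, one_div, inv_pow]
      exact inv_anti₀ (by positivity) j1
  have hmono : ∀ {Ω : Type} [Finite Ω] {A B : Set Ω}, A ⊆ B → uniformProb A ≤ uniformProb B :=
    fun h => div_le_div_of_nonneg_right (by exact_mod_cast Set.ncard_le_ncard h)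
      (Nat.cast_nonneg _)
  -- The choice `c = n^(η/2)` balances `2^j c / (4n)` against `1 / (2c)`. The three error terms are
  -- at most `4`, `1/2` and `1/2` times `n^(-η/2)`, whence `C = 5`.
  refine le_trans ?_ ((one_sub_le_uniformProb_matchingDistance (zero_lt_one.trans hn) hi hj
    (c := (n : ℝ) ^ (η / 2)) (by positivity)).trans (hmono hsub))
  rw [sub_le_sub_iff_left, Real.rpow_neg hn'.le]
  set u := (n : ℝ) ^ (η / 2) with hu
  have hu1 : 1 ≤ u := Real.one_le_rpow hn1.le (by positivity)
  have hu2 : (n : ℝ) ^ η = u ^ 2 := by rw [hu, sq, ← Real.rpow_add hn', add_halves]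
  rw [Real.rpow_add hn', Real.rpow_one, hu2, pow_succ 2 i] at i2
  rw [Real.rpow_sub hn', Real.rpow_one, hu2] at j2
  have t1 : 2 * n / (2 : ℝ) ^ i ≤ 4 * u⁻¹ := by
    rw [div_le_iff₀ (by positivity)]
    calc 2 * (n : ℝ) = 2 * u⁻¹ * (n * u) := by field_simp
      _ ≤ 2 * u⁻¹ * (n * u ^ 2) := by gcongr; nlinarith
      _ ≤ 2 * u⁻¹ * (2 ^ i * 2) := mul_le_mul_of_nonneg_left i2.le (by positivity)
      _ = _ := by ring
  have t2 : 2 ^ j * u / (4 * n) ≤ u⁻¹ / 2 := by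
    rw [div_le_iff₀ (by positivity)]
    calc 2 ^ j * u ≤ 2 * (n / u ^ 2) * u := by gcongr
      _ = _ := by field_simp; ring
  have t3 : 1 / (2 * u) = u⁻¹ / 2 := by field_simp
  linarith

end Asymptotics

end

theorem theorem3p4 :
    -- the matching distance is well defined for every instance
    (∀ (n κ : ℕ) (M : Market n κ),
      (∃ μ : Matching n, IsStable M μ) ∧
      ∀ μ : Matching n, IsStable M μ →
        ∀ x : Person n, personDist M.1 x (μ.toFun x) = matchingDistance M x) ∧
    ∀ (ε : ℝ), 0 < ε → ∀ (k : ℕ → ℕ),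
      ((∀ᶠ n : ℕ in atTop, (1 + ε) * Real.logb 2 (n : ℝ) < (k n : ℝ)) →
        (∀ δ : ℝ, 0 < δ →
          Tendsto (fun n : ℕ => uniformProb {M : Market n (k n) | multipleFraction M < δ})
            atTop (𝓝 1)) ∧
        (∀ δ : ℝ, 0 < δ →
          Tendsto (fun n : ℕ => uniformProb {p : Market n (k n) × Person n |
              0 < matchingDistance p.1 p.2 ∧
              |Real.log (matchingDistance p.1 p.2) / Real.log (n : ℝ) - (-1)| < δ})
            atTop (𝓝 1))) ∧
      ((∀ᶠ n : ℕ in atTop, (2 + ε) * Real.logb 2 (n : ℝ) < (k n : ℝ)) →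
        Tendsto (fun n : ℕ => uniformProb {M : Market n (k n) | UniqueWithoutTieBreaking M.1})
          atTop (𝓝 1)) := by
  refine ⟨fun n κ M => ⟨exists_isStable M, fun μ hμ => hμ.personDist_eq_matchingDistance⟩,
    fun ε hε k => ⟨fun hk => ⟨fun δ hδ => tendsto_uniformProb_multipleFraction hε hk hδ,
      fun δ hδ => tendsto_uniformProb_matchingDistance hε hk hδ⟩,
      fun hk => tendsto_uniformProb_uniqueWithoutTieBreaking hε hk⟩⟩
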